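/- For $y\in\mathbb R$ and $\alpha\in\mathbb C$ with $\operatorname{Re}\alpha>0$ put $y_+^\alpha:=y^\alpha$ if $y>0$ and $y_+^\alpha:=0$ if $y\le 0$; $y_-^\alpha:=|y|^\alpha$ if $y<0$ and $y_-^\alpha:=0$ if $y\ge 0$. For $\ell\in\mathbb N=\{0,1,2,\dots\}$ and $\lambda\in\mathbb C$ let $$C_\ell^\lambda(s):=\sum_{k=0}^{\lfloor \ell/2\rfloor}\frac{(-1)^k(\lambda)_{\ell-k}}{k!\,(\ell-2k)!}(2s)^{\ell-2k}$$ be the Gegenbauer polynomial, where $(\lambda)_j=\lambda(\lambda+1)\cdots(\lambda+j-1)$. For $\operatorname{Re}\lambda>-\frac12$ and $-1<s<1$ let $$u_\ell^\lambda(s):=\frac{2^{2\lambda-1}\,\ell!\,\Gamma(\lambda)}{\Gamma(2\lambda+\ell)}(1-s^2)^{\lambda-\frac12}C_\ell^\lambda(s),$$ which at $\lambda=0$ is understood as its limit $u_\ell^0(s)=(1-s^2)^{-\frac12}T_\ell(s)$, where $T_\ell$ is the Chebyshev polynomial of the first kind. **Proposition 5.1.** Let $\ell,m\in\mathbb N$,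 let $\lambda,\mu,\nu\in\mathbb C$ with $\operatorname{Re}\lambda,\operatorname{Re}\mu>-\frac12$ and $\operatorname{Re}\nu>0$, let $-1\le x\le 1$, and set $$B_{\ell,m}^{\lambda,\mu,\nu}(x):=\int_{-1}^1\int_{-1}^1(s-xt)_+^{2\nu}\,u_\ell^\lambda(s)\,u_m^\mu(t)\,ds\,dt.$$ Then this integral and the three integrals below converge absolutely, and $$\int_{-1}^1\int_{-1}^1(s-xt)_-^{2\nu}\,u_\ell^\lambda(s)\,u_m^\mu(t)\,ds\,dt=(-1)^{\ell+m}B_{\ell,m}^{\lambda,\mu,\nu}(x),$$ $$\int_{-1}^1\int_{-1}^1|s-xt|^{2\nu}\,u_\ell^\lambda(s)\,u_m^\mu(t)\,ds\,dt=\bigl(1+(-1)^{\ell+m}\bigr)B_{\ell,m}^{\lambda,\mu,\nu}(x),$$ $$\int_{-1}^1\int_{-1}^1|s-xt|^{2\nu}\operatorname{sgn}(s-xt)\,u_\ell^\lambda(s)\,u_m^\mu(t)\,ds\,dt=\bigl(1-(-1)^{\ell+m}\bigr)B_{\ell,m}^{\lambda,\mu,\nu}(x).$$ -/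

import Mathlib

noncomputable section

namespace GegenbauerIntegral

/-- The Gegenbauer (ultraspherical) polynomial of degree `l` with complex parameter `lam`, at a
real point `s`: the sum over `0 ≤ k ≤ l / 2` of
`(-1)^k (lam)_(l-k) / (k! (l-2k)!) * (2 s)^(l-2k)`, where `(lam)_j` is the Pochhammer symbol. -/
def gegenbauerC (l : ℕ) (lam : ℂ) (s : ℝ) : ℂ :=
  ∑ k ∈ Finset.range (l / 2 + 1),
    (-1 : ℂ) ^ k * (ascPochhammer ℂ (l - k)).eval lam
      / ((k.factorial : ℂ) * ((l - 2 * k).factorial : ℂ)) * (2 * (s : ℂ)) ^ (l - 2 * k)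

/-- The function `u` of degree `l` and parameter `lam`:
`2^(2 lam - 1) l! Γ(lam) / Γ(2 lam + l) * (1 - s^2)^(lam - 1/2) * C_l^lam(s)`.
At `lam = 0`, the only parameter with real part greater than `-1/2` at which a Gamma factor of
this formula has a pole, the formula has a removable singularity; there `u` is the limit value
`(1 - s^2)^(-1/2) T_l(s)`, with `T_l` the Chebyshev polynomial of the first kind. -/
def u (l : ℕ) (lam : ℂ) (s : ℝ) : ℂ :=
  if lam = 0 then
    ((1 - s ^ 2 : ℝ) : ℂ) ^ (-(1 / 2) : ℂ) * (((Polynomial.Chebyshev.T ℝ (l : ℤ)).eval s : ℝ) : ℂ)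
  else
    (2 : ℂ) ^ (2 * lam - 1) * (l.factorial : ℂ) * Complex.Gamma lam / Complex.Gamma (2 * lam + l)
      * ((1 - s ^ 2 : ℝ) : ℂ) ^ (lam - 1 / 2) * gegenbauerC l lam s

/-- The power `y_+^α`. -/
def posPow (y : ℝ) (α : ℂ) : ℂ := if 0 < y then (y : ℂ) ^ α else 0

/-- The power `y_-^α`. -/
def negPow (y : ℝ) (α : ℂ) : ℂ := if y < 0 then ((|y| : ℝ) : ℂ) ^ α else 0

/-- The power `|y|^α`. -/
def absPow (y : ℝ) (α : ℂ) : ℂ := ((|y| : ℝ) : ℂ) ^ α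

/-- The function `|y|^α sgn y`. -/
def absPowSgn (y : ℝ) (α : ℂ) : ℂ := absPow y α * ((Real.sign y : ℝ) : ℂ)

/-- The integrand `h(s - x t, 2 ν) u_l^lam(s) u_m^mu(t)`, for one of the four powers `h`. -/
def integrand (h : ℝ → ℂ → ℂ) (l m : ℕ) (lam mu nu : ℂ) (x s t : ℝ) : ℂ :=
  h (s - x * t) (2 * nu) * u l lam s * u m mu t

/-- Absolute (Lebesgue) integrability of the integrand over the square `[-1, 1]²`. -/
def IntegrableOnSquare (h : ℝ → ℂ → ℂ) (l m : ℕ) (lam mu nu : ℂ) (x : ℝ) : Prop :=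
  MeasureTheory.IntegrableOn (fun p : ℝ × ℝ => integrand h l m lam mu nu x p.1 p.2)
    (Set.Icc (-1) 1 ×ˢ Set.Icc (-1) 1) MeasureTheory.volume

/-- The double integral of the integrand, `ds` inside and `dt` outside. -/
def doubleIntegral (h : ℝ → ℂ → ℂ) (l m : ℕ) (lam mu nu : ℂ) (x : ℝ) : ℂ :=
  ∫ t in (-1 : ℝ)..1, ∫ s in (-1 : ℝ)..1, integrand h l m lam mu nu x s t

/-- The function `B` with upper indices `lam, mu, nu` and lower indices `l, m`, at `x`. -/
def B (l m : ℕ) (lam mu nu : ℂ) (x : ℝ) : ℂ := doubleIntegral posPow l m lam mu nu x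

end GegenbauerIntegral

end

open MeasureTheory

namespace GegenbauerIntegral

/-! ### Parity -/

/-! The reflection `(s, t) ↦ (-s, -t)` preserves the square, changes the sign of `s - x t`, and
multiplies `u l lam s * u m mu t` by `(-1) ^ (l + m)`. It therefore exchanges the integrals of the
two one-sided powers up to that sign (`doubleIntegral_negPow`). The other two kernels are the sum
and the difference of the one-sided powers, so linearity gives their integrals. Linearity needs
absolute convergence: the kernel is bounded on the square, and each `u` is an integrable Beta-type
weight times a polynomial. -/

lemma gegenbauerC_neg (l : ℕ) (lam : ℂ) (s : ℝ) :
    gegenbauerC l lam (-s) = (-1) ^ l * gegenbauerC l lam s := by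
  unfold gegenbauerC
  rw [Finset.mul_sum]
  refine Finset.sum_congr rfl fun k hk => ?_
  have hk' : 2 * k ≤ l := by
    have := Finset.mem_range.1 hk
    omega
  -- Exponents drop in steps of two, so every term has the parity of `l`.
  have hpar : (-1 : ℂ) ^ (l - 2 * k) = (-1) ^ l := by
    conv_rhs => rw [← Nat.sub_add_cancel hk', pow_add, pow_mul]
    simp
  have hodd : (2 * ((-s : ℝ) : ℂ)) ^ (l - 2 * k) = (-1) ^ l * (2 * (s : ℂ)) ^ (l - 2 * k) := by
    rw [← hpar, ← mul_pow]
    congr 1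
    push_cast
    ring
  rw [hodd]
  ring

lemma chebyshevT_eval_neg (l : ℕ) (s : ℝ) :
    (Polynomial.Chebyshev.T ℝ (l : ℤ)).eval (-s)
      = (-1) ^ l * (Polynomial.Chebyshev.T ℝ (l : ℤ)).eval s := by
  induction l using Nat.twoStepInduction with
  | zero => simp
  | one => simp
  | more n ih₀ ih₁ =>
    have h : (((n + 2 : ℕ) : ℤ)) = (n : ℤ) + 2 := by push_cast; ring
    have h₁ : (((n + 1 : ℕ) : ℤ)) = (n : ℤ) + 1 := by push_cast; ring
    rw [h₁] at ih₁
    rw [h, Polynomial.Chebyshev.T_add_two]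
    simp only [Polynomial.eval_sub, Polynomial.eval_mul, Polynomial.eval_X,
      Polynomial.eval_ofNat, ih₀, ih₁]
    ring

lemma u_neg (l : ℕ) (lam : ℂ) (s : ℝ) : u l lam (-s) = (-1) ^ l * u l lam s := by
  unfold u
  split_ifs
  · rw [chebyshevT_eval_neg, neg_sq]
    push_cast
    ring
  · rw [gegenbauerC_neg, neg_sq]
    ring

lemma posPow_neg (y : ℝ) (α : ℂ) : posPow (-y) α = negPow y α := by
  unfold posPow negPow
  by_cases hy : y < 0
  · simp [hy, abs_of_neg hy]
  · simp [hy]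

lemma integrand_posPow_neg (l m : ℕ) (lam mu nu : ℂ) (x s t : ℝ) :
    integrand posPow l m lam mu nu x (-s) (-t)
      = (-1) ^ (l + m) * integrand negPow l m lam mu nu x s t := by
  unfold integrand
  rw [u_neg, u_neg, show -s - x * -t = -(s - x * t) by ring, posPow_neg, pow_add]
  ring

/-! ### Relations between the four powers -/

/-- `α ≠ 0` matters only at `y = 0`: there `0 ^ 0 = 1`, while both one-sided powers vanish. -/
lemma absPow_eq_add (y : ℝ) {α : ℂ} (hα : α ≠ 0) : absPow y α = posPow y α + negPow y α := by
  unfold absPow posPow negPow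
  rcases lt_trichotomy y 0 with hy | rfl | hy
  · simp [hy, hy.not_gt]
  · simp [hα]
  · simp [hy, hy.not_gt, abs_of_pos hy]

lemma absPowSgn_eq_sub (y : ℝ) (α : ℂ) : absPowSgn y α = posPow y α - negPow y α := by
  unfold absPowSgn absPow posPow negPow
  rcases lt_trichotomy y 0 with hy | rfl | hy
  · simp [hy, hy.not_gt, Real.sign_of_neg hy]
  · simp
  · simp [hy, hy.not_gt, abs_of_pos hy, Real.sign_of_pos hy]

lemma measurable_posPow (α : ℂ) : Measurable fun y => posPow y α := by
  unfold posPow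
  exact Measurable.ite measurableSet_Ioi (by fun_prop) measurable_const

lemma norm_posPow_le {y r : ℝ} {α : ℂ} (hα : 0 ≤ α.re) (hr : 0 ≤ r) (hy : y ≤ r) :
    ‖posPow y α‖ ≤ r ^ α.re := by
  unfold posPow
  split_ifs with h
  · rw [Complex.norm_cpow_eq_rpow_re_of_pos h]
    exact Real.rpow_le_rpow h.le hy hα
  · rw [norm_zero]
    exact Real.rpow_nonneg hr _

/-! ### Integrability -/

/-- With `r = (s + 1) / 2` one has `1 - s ^ 2 = 4 r (1 - r)`, so this is the convergence of the Beta
integral with both parameters `a + 1`. -/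
lemma intervalIntegrable_one_sub_sq_cpow {a : ℂ} (ha : -1 < a.re) :
    IntervalIntegrable (fun s : ℝ => ((1 - s ^ 2 : ℝ) : ℂ) ^ a) volume (-1) 1 := by
  have hre : 0 < (a + 1).re := by
    simp only [Complex.add_re, Complex.one_re]
    linarith
  have hbeta := Complex.betaIntegral_convergent hre hre
  have hcomp := ((hbeta.comp_mul_left (c := 1 / 2)).comp_add_right 1).const_mul ((4 : ℝ) ^ a : ℂ)
  have hends : (0 / (1 / 2) - 1 : ℝ) = -1 ∧ (1 / (1 / 2) - 1 : ℝ) = 1 := by norm_num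
  rw [hends.1, hends.2] at hcomp
  refine hcomp.congr fun s hs => ?_
  rw [Set.uIoc_of_le (by norm_num)] at hs
  -- Complex powers split over a product here because the factors are nonnegative reals.
  have h₁ : 0 ≤ 1 / 2 * (s + 1) := by linarith [hs.1]
  have h₂ : 0 ≤ 1 - 1 / 2 * (s + 1) := by linarith [hs.2]
  have h := Complex.mul_cpow_ofReal_nonneg h₁ h₂ a
  have h' := Complex.mul_cpow_ofReal_nonneg (by norm_num : (0 : ℝ) ≤ 4) (mul_nonneg h₁ h₂) a
  simp only [add_sub_cancel_right]
  rw [show (1 - s ^ 2 : ℝ) = 4 * (1 / 2 * (s + 1) * (1 - 1 / 2 * (s + 1))) by ring]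
  push_cast at h h' ⊢
  rw [h', h]

lemma continuous_gegenbauerC (l : ℕ) (lam : ℂ) : Continuous (gegenbauerC l lam) := by
  unfold gegenbauerC
  fun_prop

lemma integrableOn_u (l : ℕ) {lam : ℂ} (hlam : -(1 / 2 : ℝ) < lam.re) :
    IntegrableOn (u l lam) (Set.Icc (-1) 1) := by
  rw [integrableOn_Icc_iff_integrableOn_Ioc,
    ← intervalIntegrable_iff_integrableOn_Ioc_of_le (by norm_num)]
  by_cases h : lam = 0
  · have hw := intervalIntegrable_one_sub_sq_cpow (a := -(1 / 2)) (by norm_num)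
    have hu : u l lam = fun s : ℝ => ((1 - s ^ 2 : ℝ) : ℂ) ^ (-(1 / 2) : ℂ) *
        (((Polynomial.Chebyshev.T ℝ (l : ℤ)).eval s : ℝ) : ℂ) := by
      ext s
      simp [u, h]
    rw [hu]
    exact hw.mul_continuousOn (by fun_prop)
  · have hw := intervalIntegrable_one_sub_sq_cpow (a := lam - 1 / 2) (by
      simp only [Complex.sub_re, Complex.div_ofNat_re, Complex.one_re]
      linarith)
    have hu : u l lam = fun s : ℝ =>
        (2 : ℂ) ^ (2 * lam - 1) * (l.factorial : ℂ) * Complex.Gamma lam / Complex.Gamma (2 * lam + l)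
          * ((1 - s ^ 2 : ℝ) : ℂ) ^ (lam - 1 / 2) * gegenbauerC l lam s := by
      ext s
      simp [u, h]
    rw [hu]
    exact (hw.const_mul _).mul_continuousOn (continuous_gegenbauerC l lam).continuousOn

lemma integrableOnSquare_posPow (l m : ℕ) {lam mu nu : ℂ} {x : ℝ}
    (hlam : -(1 / 2 : ℝ) < lam.re) (hmu : -(1 / 2 : ℝ) < mu.re) (hnu : 0 < nu.re)
    (hx₁ : -1 ≤ x) (hx₂ : x ≤ 1) : IntegrableOnSquare posPow l m lam mu nu x := by
  have hnu' : 0 ≤ (2 * nu).re := by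
    simp only [Complex.mul_re, Complex.re_ofNat, Complex.im_ofNat]
    linarith
  have hprod : IntegrableOn (fun p : ℝ × ℝ => u l lam p.1 * u m mu p.2)
      (Set.Icc (-1) 1 ×ˢ Set.Icc (-1) 1) volume := by
    rw [IntegrableOn, Measure.volume_eq_prod, ← Measure.prod_restrict]
    exact (integrableOn_u l hlam).mul_prod (integrableOn_u m hmu)
  have hmeas : Measurable fun p : ℝ × ℝ => posPow (p.1 - x * p.2) (2 * nu) :=
    (measurable_posPow (2 * nu)).comp (by fun_prop)
  unfold IntegrableOnSquare
  simp only [integrand, mul_assoc (posPow _ _)]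
  refine Integrable.bdd_mul (c := 2 ^ (2 * nu).re) hprod hmeas.aestronglyMeasurable ?_
  filter_upwards [ae_restrict_mem (measurableSet_Icc.prod measurableSet_Icc)] with p hp
  refine norm_posPow_le hnu' zero_le_two ?_
  obtain ⟨⟨_, hs⟩, ht₁, ht₂⟩ := hp
  -- `s - x t ≤ 1 + |x| |t| ≤ 2`, whence the constant `2 ^ (2 * nu).re`.
  nlinarith [abs_mul x p.2, neg_abs_le (x * p.2),
    mul_le_one₀ (abs_le.2 ⟨hx₁, hx₂⟩) (abs_nonneg p.2) (abs_le.2 ⟨ht₁, ht₂⟩)]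

/-- Fubini. Over the square, additivity needs only joint integrability, not integrability of each
slice. -/
lemma doubleIntegral_eq_setIntegral {h : ℝ → ℂ → ℂ} {l m : ℕ} {lam mu nu : ℂ} {x : ℝ}
    (hi : IntegrableOnSquare h l m lam mu nu x) :
    doubleIntegral h l m lam mu nu x
      = ∫ p in Set.Icc (-1 : ℝ) 1 ×ˢ Set.Icc (-1 : ℝ) 1, integrand h l m lam mu nu x p.1 p.2 := by
  unfold IntegrableOnSquare at hi
  rw [IntegrableOn, Measure.volume_eq_prod, ← Measure.prod_restrict] at hi
  rw [Measure.volume_eq_prod, ← Measure.prod_restrict, integral_prod_symm _ hi, doubleIntegral]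
  simp only [intervalIntegral.integral_of_le (show (-1 : ℝ) ≤ 1 by norm_num),
    integral_Icc_eq_integral_Ioc]

lemma integrand_negPow_eq (l m : ℕ) (lam mu nu : ℂ) (x : ℝ) (p : ℝ × ℝ) :
    integrand negPow l m lam mu nu x p.1 p.2
      = (-1) ^ (l + m) * integrand posPow l m lam mu nu x (-p).1 (-p).2 := by
  rw [Prod.fst_neg, Prod.snd_neg, integrand_posPow_neg, ← mul_assoc, ← mul_pow]
  simp

lemma integrableOnSquare_negPow {l m : ℕ} {lam mu nu : ℂ} {x : ℝ}
    (h : IntegrableOnSquare posPow l m lam mu nu x) :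
    IntegrableOnSquare negPow l m lam mu nu x := by
  unfold IntegrableOnSquare at h ⊢
  simp only [integrand_negPow_eq]
  have h' := h.comp_neg
  rw [Set.neg_prod, Set.neg_Icc, neg_neg] at h'
  exact h'.const_mul _

/-- Reflecting each variable separately is valid for the iterated integral without any
integrability. -/
lemma doubleIntegral_negPow (l m : ℕ) (lam mu nu : ℂ) (x : ℝ) :
    doubleIntegral negPow l m lam mu nu x = (-1) ^ (l + m) * B l m lam mu nu x := by
  unfold B doubleIntegral
  have hneg (s t : ℝ) : integrand negPow l m lam mu nu x s t
      = (-1) ^ (l + m) * integrand posPow l m lam mu nu x (-s) (-t) :=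
    integrand_negPow_eq l m lam mu nu x (s, t)
  simp only [hneg, intervalIntegral.integral_const_mul]
  congr 1
  have hs (t : ℝ) : ∫ s in (-1 : ℝ)..1, integrand posPow l m lam mu nu x (-s) (-t)
      = ∫ s in (-1 : ℝ)..1, integrand posPow l m lam mu nu x s (-t) := by
    rw [intervalIntegral.integral_comp_neg fun s => integrand posPow l m lam mu nu x s (-t),
      neg_neg]
  simp only [hs]
  rw [intervalIntegral.integral_comp_neg
    fun t => ∫ s in (-1 : ℝ)..1, integrand posPow l m lam mu nu x s t, neg_neg]

lemma integrand_absPow_eq_add {nu : ℂ} (hnu : nu ≠ 0) (l m : ℕ) (lam mu : ℂ) (x s t : ℝ) :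
    integrand absPow l m lam mu nu x s t
      = integrand posPow l m lam mu nu x s t + integrand negPow l m lam mu nu x s t := by
  unfold integrand
  rw [absPow_eq_add _ (mul_ne_zero two_ne_zero hnu)]
  ring

lemma integrand_absPowSgn_eq_sub (l m : ℕ) (lam mu nu : ℂ) (x s t : ℝ) :
    integrand absPowSgn l m lam mu nu x s t
      = integrand posPow l m lam mu nu x s t - integrand negPow l m lam mu nu x s t := by
  unfold integrand
  rw [absPowSgn_eq_sub]
  ring

end GegenbauerIntegral

open GegenbauerIntegral

theorem proposition5p1 (l m : ℕ) (lam mu nu : ℂ) (x : ℝ)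
    (hlam : -(1 / 2 : ℝ) < lam.re) (hmu : -(1 / 2 : ℝ) < mu.re) (hnu : 0 < nu.re)
    (hx₁ : -1 ≤ x) (hx₂ : x ≤ 1) :
    (GegenbauerIntegral.IntegrableOnSquare GegenbauerIntegral.posPow l m lam mu nu x ∧
      GegenbauerIntegral.IntegrableOnSquare GegenbauerIntegral.negPow l m lam mu nu x ∧
      GegenbauerIntegral.IntegrableOnSquare GegenbauerIntegral.absPow l m lam mu nu x ∧
      GegenbauerIntegral.IntegrableOnSquare GegenbauerIntegral.absPowSgn l m lam mu nu x) ∧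
    GegenbauerIntegral.doubleIntegral GegenbauerIntegral.negPow l m lam mu nu x
      = (-1 : ℂ) ^ (l + m) * GegenbauerIntegral.B l m lam mu nu x ∧
    GegenbauerIntegral.doubleIntegral GegenbauerIntegral.absPow l m lam mu nu x
      = (1 + (-1 : ℂ) ^ (l + m)) * GegenbauerIntegral.B l m lam mu nu x ∧
    GegenbauerIntegral.doubleIntegral GegenbauerIntegral.absPowSgn l m lam mu nu x
      = (1 - (-1 : ℂ) ^ (l + m)) * GegenbauerIntegral.B l m lam mu nu x := by
  have hpos := integrableOnSquare_posPow l m hlam hmu hnu hx₁ hx₂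
  have hneg := integrableOnSquare_negPow hpos
  have hnu₀ : nu ≠ 0 := by
    rintro rfl
    simp at hnu
  have habs : IntegrableOnSquare absPow l m lam mu nu x := by
    unfold IntegrableOnSquare
    simp only [integrand_absPow_eq_add hnu₀]
    exact hpos.add hneg
  have hsgn : IntegrableOnSquare absPowSgn l m lam mu nu x := by
    unfold IntegrableOnSquare
    simp only [integrand_absPowSgn_eq_sub]
    exact hpos.sub hneg
  have hnegI := doubleIntegral_negPow l m lam mu nu x
  refine ⟨⟨hpos, hneg, habs, hsgn⟩, hnegI, ?_, ?_⟩
  · rw [doubleIntegral_eq_setIntegral habs]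
    simp only [integrand_absPow_eq_add hnu₀]
    rw [integral_add hpos hneg, ← doubleIntegral_eq_setIntegral hpos,
      ← doubleIntegral_eq_setIntegral hneg, hnegI, B]
    ring
  · rw [doubleIntegral_eq_setIntegral hsgn]
    simp only [integrand_absPowSgn_eq_sub]
    rw [integral_sub hpos hneg, ← doubleIntegral_eq_setIntegral hpos,
      ← doubleIntegral_eq_setIntegral hneg, hnegI, B]
    ring
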